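/- Let $\rho$ and $\sigma$ be states of an $n$-dimensional quantum system ($n\ge 1$), i.e. positive semidefinite complex $n\times n$ matrices of trace one. A Noisy Operation is a finite composition of the following actions: adding a system of any finite dimension $d$ in the maximally mixed state $\mathbb{I}/d$, discarding any subsystem through the partial trace, and applying any unitary to the global system; write $\rho\stackrel{NO}{\longrightarrow}\rho'$ if some Noisy Operation maps $\rho$ to $\rho'$. For $l\in\{1,\dots,n\}$ let $V_l(\rho)$ be the sum of the $l$ largest eigenvalues of $\rho$, counted with multiplicity. Then the maximum value of $p\in[0,1]$ for which there is a state $X$ of the system with $$\rho\stackrel{NO}{\longrightarrow} p\,\sigma+(1-p)\,X$$ exists and is given by $$p^{*}=\min_{l\in\{1,\dots,n\}}\frac{V_l(\rho)}{V_l(\sigma)}.$$ -/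

import Mathlib

universe u

open scoped Kronecker ComplexOrder

noncomputable section

/-- A state of a quantum system with orthonormal basis indexed by `n`: a positive semidefinite
complex matrix of trace one. -/
structure DensityMatrix (n : Type u) [Fintype n] where
  toMatrix : Matrix n n ℂ
  posSemidef : toMatrix.PosSemidef
  trace_eq_one : toMatrix.trace = 1

namespace DensityMatrix

variable {n : Type u} [Fintype n] [DecidableEq n]

/-- The eigenvalues `η₁ ≥ η₂ ≥ …` of a state, with multiplicity, in decreasing order
(indexed from `0`). -/
def eigenvalue (ρ : DensityMatrix n) : Fin (Fintype.card n) → ℝ :=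
  ρ.posSemidef.isHermitian.eigenvalues₀

/-- `V l ρ` is the sum of the `l` largest eigenvalues of `ρ`. -/
def V (l : ℕ) (ρ : DensityMatrix n) : ℝ :=
  ∑ i : Fin (Fintype.card n) with i.val < l, ρ.eigenvalue i

end DensityMatrix

namespace NoisyOperation

/-- Adding an ancillary system `κ` in the maximally mixed state: `A ↦ A ⊗ 𝟙 / |κ|`. -/
def addMixed (a κ : Type u) [Fintype κ] [DecidableEq κ] :
    Matrix a a ℂ →ₗ[ℂ] Matrix (a × κ) (a × κ) ℂ where
  toFun A := A ⊗ₖ ((Fintype.card κ : ℂ)⁻¹ • (1 : Matrix κ κ ℂ))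
  map_add' A B := Matrix.add_kronecker A B _
  map_smul' c A := Matrix.smul_kronecker c A _

/-- Discarding the subsystem `κ`: the partial trace over the second tensor factor. -/
def discard (a κ : Type u) [Fintype κ] :
    Matrix (a × κ) (a × κ) ℂ →ₗ[ℂ] Matrix a a ℂ where
  toFun M := Matrix.of fun i j => ∑ k, M (i, k) (j, k)
  map_add' M N := by
    ext i j
    simp [Finset.sum_add_distrib]
  map_smul' c M := by
    ext i j
    simp [Finset.mul_sum]

/-- Applying a unitary to the whole system: `A ↦ U A U†`. -/
def applyUnitary {a : Type u} [Fintype a] [DecidableEq a] (U : Matrix.unitaryGroup a ℂ) :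
    Matrix a a ℂ →ₗ[ℂ] Matrix a a ℂ where
  toFun A := (U : Matrix a a ℂ) * A * (U : Matrix a a ℂ).conjTranspose
  map_add' A B := by rw [mul_add, add_mul]
  map_smul' c A := by simp

end NoisyOperation

/-- Noisy Operations: the linear maps obtained as finite compositions of the three allowed
actions (adding a finite-dimensional system in the maximally mixed state, discarding a subsystem,
applying a unitary to the whole system). The constructor `relabel` only renames basis vectors along
a bijection of index sets; it serves to regard a finite-dimensional system as a composite of
subsystems, so that any subsystem may be the one that is discarded. -/
inductive IsNoisyOperation : ∀ {a b : Type u}, (Matrix a a ℂ →ₗ[ℂ] Matrix b b ℂ) → Prop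
  | addMixed (a κ : Type u) [Fintype a] [Fintype κ] [DecidableEq κ] [Nonempty κ] :
      IsNoisyOperation (NoisyOperation.addMixed a κ)
  | discard (a κ : Type u) [Fintype a] [Fintype κ] [Nonempty κ] :
      IsNoisyOperation (NoisyOperation.discard a κ)
  | applyUnitary {a : Type u} [Fintype a] [DecidableEq a] (U : Matrix.unitaryGroup a ℂ) :
      IsNoisyOperation (NoisyOperation.applyUnitary U)
  | relabel {a b : Type u} [Fintype a] [Fintype b] (e : a ≃ b) :
      IsNoisyOperation (Matrix.reindexLinearEquiv ℂ ℂ e e).toLinearMap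
  | comp {a b c : Type u} [Fintype a] [Fintype b] [Fintype c]
      {E : Matrix a a ℂ →ₗ[ℂ] Matrix b b ℂ} {F : Matrix b b ℂ →ₗ[ℂ] Matrix c c ℂ} :
      IsNoisyOperation E → IsNoisyOperation F → IsNoisyOperation (F ∘ₗ E)

/-- The probabilities `p` for which some Noisy Operation takes `ρ` to `p σ + (1 - p) X`
for some state `X`. -/
def noisyTransitionProbabilities {n : Type u} [Fintype n] (ρ σ : DensityMatrix n) : Set ℝ :=
  {p | 0 ≤ p ∧ p ≤ 1 ∧
    ∃ (X : DensityMatrix n) (E : Matrix n n ℂ →ₗ[ℂ] Matrix n n ℂ), IsNoisyOperation E ∧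
      E ρ.toMatrix = (p : ℂ) • σ.toMatrix + (1 - p : ℂ) • X.toMatrix}

end

/-! Upper bound: a noisy operation `E` is positive, trace preserving and, between equal dimensions,
unital. With `t` the `l`-th eigenvalue of `ρ` and `B` the positive part of `ρ - t`, one has `ρ ≤ t +
B` and `l t + tr B = V l ρ` (`exists_threshold`). Applying `E` gives `p σ ≤ E ρ ≤ t + E B`, and
summing `l` diagonal entries in the eigenbasis of `σ` yields `p V l σ ≤ V l ρ` (`mul_V_le`).

Attainment: if `p V l σ ≤ V l ρ` for all `l`, the spectrum of `p σ` is weakly majorized by that of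
`ρ`, so it lies below some `z` that is majorized with equal sum (`exists_majorized_ge`). Finitely
many two-entry transfers lead from the spectrum of `ρ` to `z` (`transfer_induction`), and each is a
noisy operation with one maximally mixed qubit (`exists_mix_involution`). The excess of `z` over the
spectrum of `p σ` becomes `(1 - p) X`. -/

section PartialSums

variable {N : ℕ}

/-! ### Majorization of real vectors -/

theorem Fin.sum_filter_val_lt_succ (f : Fin N → ℝ) {l : ℕ} (hl : l < N) :
    ∑ i : Fin N with i.val < l + 1, f i = (∑ i : Fin N with i.val < l, f i) + f ⟨l, hl⟩ := by
  have h : (Finset.univ.filter fun i : Fin N => i.val < l + 1)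
      = insert ⟨l, hl⟩ (Finset.univ.filter fun i : Fin N => i.val < l) := by
    ext i
    simp only [Finset.mem_filter, Finset.mem_univ, true_and, Finset.mem_insert, Fin.ext_iff]
    omega
  rw [h, Finset.sum_insert (by simp), add_comm]

theorem Fin.sum_filter_val_lt_self (f : Fin N → ℝ) :
    ∑ i : Fin N with i.val < N, f i = ∑ i, f i := by
  rw [Finset.filter_true_of_mem fun i _ => i.isLt]

/-- A weakly majorized vector lies below a majorized one, obtained by raising its small entries to
a common value. -/
theorem exists_majorized_ge {q r : Fin N → ℝ} (hq : Antitone q) (hr : Antitone r)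
    (hqr : ∀ l ≤ N, ∑ i : Fin N with i.val < l, q i ≤ ∑ i : Fin N with i.val < l, r i) :
    ∃ z : Fin N → ℝ, Antitone z ∧ q ≤ z ∧ ∑ i, z i = ∑ i, r i ∧
      ∀ l ≤ N, ∑ i : Fin N with i.val < l, z i ≤ ∑ i : Fin N with i.val < l, r i := by
  rcases Nat.eq_zero_or_pos N with rfl | hN
  · exact ⟨q, hq, le_rfl, by simp, hqr⟩
  -- The level `c` comes from the intermediate value theorem.
  obtain ⟨c, hc⟩ : ∃ c : ℝ, ∑ i, max (q i) c = ∑ i, r i := by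
    have hcont : Continuous fun c : ℝ => ∑ i, max (q i) c := by fun_prop
    have hlow : ∑ i, max (q i) (q ⟨N - 1, by omega⟩) ≤ ∑ i, r i := by
      refine le_trans (le_of_eq ?_) ((Fin.sum_filter_val_lt_self q ▸
        Fin.sum_filter_val_lt_self r ▸ hqr N le_rfl))
      refine Finset.sum_congr rfl fun i _ => max_eq_left (hq ?_)
      rw [Fin.le_def]; simp only; omega
    have hhigh : ∑ i, r i ≤ ∑ i, max (q i) (r ⟨0, hN⟩) :=
      Finset.sum_le_sum fun i _ => le_max_of_le_right (hr (Fin.le_def.2 (Nat.zero_le _)))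
    exact mem_range_of_exists_le_of_exists_ge hcont ⟨_, hlow⟩ ⟨_, hhigh⟩
  refine ⟨fun i => max (q i) c, fun i j h => max_le_max_right _ (hq h), fun i => le_max_left _ _,
    hc, fun l => ?_⟩
  induction l with
  | zero => simp
  | succ l ih =>
    intro hl
    -- If `r` is already below `c`, compare the tails and use the equal totals; otherwise compare
    -- with `q` on the prefix, or add one entry `c ≤ r l` to the previous bound.
    rcases lt_or_ge (r ⟨l, hl⟩) c with hlt | hge
    · have hsplit := fun f : Fin N → ℝ =>
        Finset.sum_filter_add_sum_filter_not Finset.univ (fun i : Fin N => i.val < l + 1) f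
      have htail : ∑ i : Fin N with ¬ i.val < l + 1, r i
          ≤ ∑ i : Fin N with ¬ i.val < l + 1, max (q i) c := by
        refine Finset.sum_le_sum fun i hi => le_max_of_le_right (le_trans (hr ?_) hlt.le)
        rw [Fin.le_def]
        have := (Finset.mem_filter.1 hi).2
        simp only
        omega
      linarith [hsplit r, hsplit fun i => max (q i) c]
    · rcases le_total c (q ⟨l, hl⟩) with hcq | hcq
      · refine le_trans (le_of_eq ?_) (hqr (l + 1) hl)
        refine Finset.sum_congr rfl fun i hi => max_eq_left (hcq.trans (hq ?_))
        rw [Fin.le_def]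
        have := (Finset.mem_filter.1 hi).2
        simp only
        omega
      · rw [Fin.sum_filter_val_lt_succ _ hl, Fin.sum_filter_val_lt_succ _ hl, max_eq_right hcq]
        linarith [ih (Nat.le_of_succ_le hl)]

/-- One transfer step: if `a ≠ b` majorizes the decreasing vector `b`, some transfer on `a` yields
a vector which still majorizes `b` and agrees with it in more entries. -/
theorem exists_transfer {a b : Fin N → ℝ} (hb : Antitone b) (hab : a ≠ b)
    (hsum : ∑ i, a i = ∑ i, b i)
    (hle : ∀ l ≤ N, ∑ i : Fin N with i.val < l, b i ≤ ∑ i : Fin N with i.val < l, a i) :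
    ∃ (j k : Fin N) (t : ℝ) (a' : Fin N → ℝ), 0 ≤ t ∧ t ≤ 1 ∧
      (a' = fun i => t * a i + (1 - t) * a (Equiv.swap j k i)) ∧
      ∑ i, a' i = ∑ i, b i ∧
      (∀ l ≤ N, ∑ i : Fin N with i.val < l, b i ≤ ∑ i : Fin N with i.val < l, a' i) ∧
      (Finset.univ.filter fun i => a' i ≠ b i).card
        < (Finset.univ.filter fun i => a i ≠ b i).card := by
  obtain ⟨k, hk, hkmin⟩ : ∃ k, a k < b k ∧ ∀ i < k, b i ≤ a i := by
    have hex : (Finset.univ.filter fun i => a i < b i).Nonempty := by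
      by_contra hne
      rw [Finset.not_nonempty_iff_eq_empty, Finset.filter_eq_empty_iff] at hne
      have hba : ∀ i ∈ Finset.univ, b i ≤ a i := fun i hi => not_lt.1 (hne hi)
      exact hab (funext fun i =>
        ((Finset.sum_eq_sum_iff_of_le hba).1 hsum.symm i (Finset.mem_univ i)).symm)
    obtain ⟨k, hk, hmin⟩ := Finset.exists_min_image _ id hex
    refine ⟨k, (Finset.mem_filter.1 hk).2, fun i hi => not_lt.1 fun hlt => ?_⟩
    exact not_le.2 hi (hmin i (Finset.mem_filter.2 ⟨Finset.mem_univ i, hlt⟩))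
  -- A surplus must precede the first deficit `k`, or the partial sum through `k` would be too
  -- small.
  obtain ⟨j, hjk, hj⟩ : ∃ j < k, b j < a j := by
    by_contra! hne
    have h1 := hle (k + 1) k.isLt
    rw [Fin.sum_filter_val_lt_succ _ k.isLt, Fin.sum_filter_val_lt_succ _ k.isLt] at h1
    have h2 : ∑ i : Fin N with i.val < k.val, a i ≤ ∑ i : Fin N with i.val < k.val, b i :=
      Finset.sum_le_sum fun i hi => hne i (Fin.lt_def.2 (Finset.mem_filter.1 hi).2)
    simp only [Fin.eta] at h1
    linarith
  have hjk' : j ≠ k := hjk.ne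
  have hbjk : b k ≤ b j := hb hjk.le
  -- Moving the smaller of surplus and deficit makes one of the entries `j`, `k` final.
  obtain ⟨δ, hδ0, hδ1, hδ⟩ : ∃ δ : ℝ, 0 < δ ∧ δ ≤ a j - b j ∧ (δ = a j - b j ∨ δ = b k - a k) :=
    ⟨_, lt_min (sub_pos.2 hj) (sub_pos.2 hk), min_le_left _ _, min_choice _ _⟩
  have hd : 0 < a j - a k := by linarith
  obtain ⟨a', ha'⟩ : ∃ a' : Fin N → ℝ,
      a' = fun i => a i + ((if i = k then δ else 0) - if i = j then δ else 0) := ⟨_, rfl⟩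
  have ha'j : a' j = a j - δ := by simp [ha', hjk']; ring
  have ha'k : a' k = a k + δ := by simp [ha', hjk'.symm]
  have ha'i : ∀ i, i ≠ j → i ≠ k → a' i = a i := fun i h1 h2 => by simp [ha', h1, h2]
  refine ⟨j, k, 1 - δ / (a j - a k), a', ?_, ?_, ?_, ?_, ?_, ?_⟩
  · rw [sub_nonneg, div_le_one hd]; linarith
  · linarith [div_pos hδ0 hd]
  · funext i
    by_cases h1 : i = j
    · subst h1
      rw [ha'j, Equiv.swap_apply_left]
      field_simp
      ring
    by_cases h2 : i = k
    · subst h2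
      rw [ha'k, Equiv.swap_apply_right]
      field_simp
      ring
    · rw [ha'i i h1 h2, Equiv.swap_apply_of_ne_of_ne h1 h2]
      ring
  · rw [← hsum, ha']
    simp [Finset.sum_add_distrib]
  · intro l hl
    have hform : ∑ i : Fin N with i.val < l, a' i
        = (∑ i : Fin N with i.val < l, a i)
          + ((if k.val < l then δ else 0) - if j.val < l then δ else 0) := by
      simp only [ha', Finset.sum_add_distrib, Finset.sum_sub_distrib, Finset.sum_ite_eq',
        Finset.mem_filter, Finset.mem_univ, true_and]
    rw [hform]
    have hjk2 : j.val < k.val := hjk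
    by_cases hkl : k.val < l
    · rw [if_pos hkl, if_pos (hjk2.trans hkl)]
      linarith [hle l hl]
    · rw [if_neg hkl]
      by_cases hjl : j.val < l
      · rw [if_pos hjl]
        -- Before `k` there are only surpluses, so a prefix containing `j` has slack at least `a j -
        -- b j ≥ δ`.
        have hnn : ∀ i ∈ Finset.univ.filter fun i : Fin N => i.val < l, 0 ≤ a i - b i := by
          intro i hi
          have := (Finset.mem_filter.1 hi).2
          exact sub_nonneg.2 (hkmin i (Fin.lt_def.2 (by omega)))
        have h1 := Finset.single_le_sum hnn
          (Finset.mem_filter.2 ⟨Finset.mem_univ j, hjl⟩)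
        rw [Finset.sum_sub_distrib] at h1
        linarith
      · rw [if_neg hjl]
        linarith [hle l hl]
  · have hsub : (Finset.univ.filter fun i => a' i ≠ b i)
        ⊆ Finset.univ.filter fun i => a i ≠ b i := by
      intro i hi
      simp only [Finset.mem_filter, Finset.mem_univ, true_and] at hi ⊢
      by_cases h1 : i = j
      · rw [h1]; exact hj.ne'
      by_cases h2 : i = k
      · rw [h2]; exact hk.ne
      rwa [ha'i i h1 h2] at hi
    refine Finset.card_lt_card ((Finset.ssubset_iff_of_subset hsub).2 ?_)
    rcases hδ with h | h
    · refine ⟨j, by simpa using hj.ne', ?_⟩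
      simp only [Finset.mem_filter, Finset.mem_univ, true_and, not_not]
      rw [ha'j, h]; ring
    · refine ⟨k, by simpa using hk.ne, ?_⟩
      simp only [Finset.mem_filter, Finset.mem_univ, true_and, not_not]
      rw [ha'k, h]; ring

/-- Hardy–Littlewood–Pólya: a vector which majorizes the decreasing vector `b` can be taken to `b`
by finitely many transfers. -/
theorem transfer_induction {S : (Fin N → ℝ) → Prop}
    (hS : ∀ (a : Fin N → ℝ) (j k : Fin N) (t : ℝ), 0 ≤ t → t ≤ 1 → S a →
      S fun i => t * a i + (1 - t) * a (Equiv.swap j k i))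
    {a b : Fin N → ℝ} (hb : Antitone b) (hsum : ∑ i, a i = ∑ i, b i)
    (hle : ∀ l ≤ N, ∑ i : Fin N with i.val < l, b i ≤ ∑ i : Fin N with i.val < l, a i)
    (ha : S a) : S b := by
  induction hm : (Finset.univ.filter fun i => a i ≠ b i).card using Nat.strong_induction_on
    generalizing a with
  | _ m ih =>
    by_cases hab : a = b
    · exact hab ▸ ha
    obtain ⟨j, k, t, a', ht0, ht1, ha', hsum', hle', hcard⟩ := exists_transfer hb hab hsum hle
    exact ih _ (hm ▸ hcard) hsum' hle' (ha' ▸ hS a j k t ht0 ht1 ha) rfl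

end PartialSums

/-! ### Invariants and constructions of noisy operations -/

namespace IsNoisyOperation

open Matrix

theorem map_posSemidef {a b : Type u} {E : Matrix a a ℂ →ₗ[ℂ] Matrix b b ℂ}
    (hE : IsNoisyOperation E) : ∀ {A : Matrix a a ℂ}, A.PosSemidef → (E A).PosSemidef := by
  induction hE with
  | addMixed a κ =>
    intro A hA
    refine hA.kronecker (PosSemidef.one.smul ?_)
    rw [← Complex.ofReal_natCast, ← Complex.ofReal_inv]
    exact Complex.zero_le_real.2 (by positivity)
  | discard a κ =>
    intro A hA
    have h : NoisyOperation.discard a κ A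
        = ∑ k, A.submatrix (fun i => (i, k)) (fun i => (i, k)) := by
      ext i j
      simp [NoisyOperation.discard, Matrix.sum_apply]
    rw [h]
    exact posSemidef_sum _ fun k _ => hA.submatrix _
  | applyUnitary U => exact fun hA => hA.mul_mul_conjTranspose_same _
  | relabel e => exact fun hA => hA.submatrix _
  | comp _ _ ih₁ ih₂ => exact fun hA => ih₂ (ih₁ hA)

theorem trace_map {a b : Type u} {E : Matrix a a ℂ →ₗ[ℂ] Matrix b b ℂ}
    (hE : IsNoisyOperation E) :
    ∀ [Fintype a] [Fintype b] (A : Matrix a a ℂ), (E A).trace = A.trace := by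
  induction hE with
  | addMixed a κ =>
    intro _ _ A
    obtain rfl := Subsingleton.elim ‹Fintype (a × κ)› (instFintypeProd a κ)
    refine (trace_kronecker A _).trans ?_
    have hκ : (Fintype.card κ : ℂ) ≠ 0 := Nat.cast_ne_zero.2 Fintype.card_ne_zero
    rw [trace_smul, trace_one, smul_eq_mul, inv_mul_cancel₀ hκ, mul_one]
  | discard a κ =>
    intro _ _ A
    simp only [trace, NoisyOperation.discard, diag_apply, LinearMap.coe_mk, AddHom.coe_mk, of_apply]
    rw [← Fintype.sum_prod_type (fun x : a × κ => A x x)]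
    congr!
  | applyUnitary U =>
    intro _ _ A
    rename_i i₁ i₂ i₃ i₄
    obtain rfl := Subsingleton.elim i₃ i₁
    obtain rfl := Subsingleton.elim i₄ i₃
    change ((U : Matrix _ _ ℂ) * A * (U : Matrix _ _ ℂ)ᴴ).trace = _
    rw [trace_mul_cycle, ← star_eq_conjTranspose, UnitaryGroup.star_mul_self, one_mul]
  | relabel e =>
    intro _ _ A
    simp only [trace, LinearEquiv.coe_coe, coe_reindexLinearEquiv, diag_apply, reindex_apply,
      submatrix_apply]
    exact Equiv.sum_comp e.symm fun i => A i i
  | comp _ _ ih₁ ih₂ =>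
    intro _ _ A
    exact (ih₂ _).trans (ih₁ A)

/-- The scalar allows for intermediate systems of other dimensions; preservation of the trace fixes
it once input and output agree. -/
theorem exists_map_one {a b : Type u} {E : Matrix a a ℂ →ₗ[ℂ] Matrix b b ℂ}
    (hE : IsNoisyOperation E) :
    ∀ [DecidableEq a] [DecidableEq b], ∃ c : ℂ, E 1 = c • (1 : Matrix b b ℂ) := by
  induction hE with
  | addMixed a κ =>
    intro _ _
    obtain rfl := Subsingleton.elim ‹DecidableEq (a × κ)› instDecidableEqProd
    refine ⟨(Fintype.card κ : ℂ)⁻¹, (kronecker_smul _ _ _).trans ?_⟩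
    rw [one_kronecker_one]
  | discard a κ =>
    intro _ _
    refine ⟨Fintype.card κ, ?_⟩
    ext i j
    by_cases h : i = j <;> simp [NoisyOperation.discard, Matrix.one_apply, h]
  | applyUnitary U =>
    intro _ _
    rename_i a _ i₁ i₂ i₃
    obtain rfl := Subsingleton.elim i₂ i₁
    obtain rfl := Subsingleton.elim i₃ i₂
    refine ⟨1, ?_⟩
    change (U : Matrix a a ℂ) * 1 * (U : Matrix a a ℂ)ᴴ = _
    rw [mul_one, ← star_eq_conjTranspose, mem_unitaryGroup_iff.1 U.2, one_smul]
  | relabel e =>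
    intro _ _
    refine ⟨1, ?_⟩
    simp
  | comp _ _ ih₁ ih₂ =>
    intro _ _
    classical
    obtain ⟨c₁, h₁⟩ := ih₁
    obtain ⟨c₂, h₂⟩ := ih₂
    exact ⟨c₁ * c₂, by rw [LinearMap.comp_apply, h₁, map_smul, h₂, smul_smul]⟩

theorem map_one {n : Type u} [Fintype n] [DecidableEq n] [Nonempty n]
    {E : Matrix n n ℂ →ₗ[ℂ] Matrix n n ℂ} (hE : IsNoisyOperation E) : E 1 = 1 := by
  obtain ⟨c, hc⟩ := hE.exists_map_one
  have h := hE.trace_map 1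
  rw [hc, trace_smul, trace_one, smul_eq_mul] at h
  rw [hc, (mul_eq_right₀ (Nat.cast_ne_zero.2 Fintype.card_ne_zero)).1 h, one_smul]

/-- Mixtures of two unitary evolutions with equal weights are noisy operations. -/
theorem exists_average {n : Type u} [Fintype n] [DecidableEq n] (U V : unitaryGroup n ℂ) :
    ∃ E : Matrix n n ℂ →ₗ[ℂ] Matrix n n ℂ, IsNoisyOperation E ∧
      ∀ A, E A = (2⁻¹ : ℂ) • ((U : Matrix n n ℂ) * A * (U : Matrix n n ℂ)ᴴ
        + (V : Matrix n n ℂ) * A * (V : Matrix n n ℂ)ᴴ) := by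
  -- The mixed qubit controls which unitary acts; tracing it out leaves the average.
  let κ : Type u := ULift Bool
  let B : κ → Matrix n n ℂ := fun k => bif k.down then U else V
  have hB : blockDiagonal B ∈ unitaryGroup (n × κ) ℂ := by
    rw [mem_unitaryGroup_iff, star_eq_conjTranspose, blockDiagonal_conjTranspose,
      ← blockDiagonal_mul, ← blockDiagonal_one]
    congr 1
    funext k
    obtain ⟨_ | _⟩ := k
    · exact mem_unitaryGroup_iff.1 V.2
    · exact mem_unitaryGroup_iff.1 U.2
  refine ⟨_, ((addMixed n κ).comp (applyUnitary ⟨_, hB⟩)).comp (discard n κ), fun A => ?_⟩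
  have hA : NoisyOperation.addMixed n κ A = blockDiagonal fun _ => (2⁻¹ : ℂ) • A := by
    ext ⟨i, k⟩ ⟨j, l⟩
    by_cases h : k = l <;>
      simp [NoisyOperation.addMixed, blockDiagonal_apply, h, κ, mul_comm]
  have hU : NoisyOperation.applyUnitary ⟨_, hB⟩ (NoisyOperation.addMixed n κ A)
      = blockDiagonal fun k => B k * ((2⁻¹ : ℂ) • A) * (B k)ᴴ := by
    rw [hA]
    change blockDiagonal B * _ * (blockDiagonal B)ᴴ = _
    rw [blockDiagonal_conjTranspose, blockDiagonal_mul, blockDiagonal_mul]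
  rw [LinearMap.comp_apply, LinearMap.comp_apply, hU]
  have hsum : ∀ f : κ → ℂ, ∑ k, f k = f ⟨true⟩ + f ⟨false⟩ := fun f => by
    rw [← Equiv.ulift.symm.sum_comp, Fintype.sum_bool]; rfl
  ext i j
  simp [NoisyOperation.discard, blockDiagonal_apply, hsum, B, mul_add]

/-- For a self-adjoint unitary `P`, the evolution `P` may be applied with any probability. -/
theorem exists_mix_involution {n : Type u} [Fintype n] [DecidableEq n] {P : Matrix n n ℂ}
    (hP : Pᴴ = P) (hPP : P * P = 1) {t : ℝ} (ht0 : 0 ≤ t) (ht1 : t ≤ 1) :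
    ∃ E : Matrix n n ℂ →ₗ[ℂ] Matrix n n ℂ, IsNoisyOperation E ∧
      ∀ A, E A = (t : ℂ) • A + (1 - t : ℂ) • (P * A * P) := by
  -- Since `s` is imaginary, `c + s P` and `c - s P` are unitary; averaging their actions cancels
  -- the cross terms `P A` and `A P`, leaving weights `t` and `1 - t`.
  let c : ℂ := (Real.sqrt t : ℂ)
  let s : ℂ := (Real.sqrt (1 - t) : ℂ) * Complex.I
  have hc : star c = c := Complex.conj_ofReal _
  have hs : star s = -s := by simp [s]
  have hcc : c * c = t := by
    simp only [c, ← Complex.ofReal_mul, Real.mul_self_sqrt ht0]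
  have hss : s * s = -(1 - t) := by
    have h : ((Real.sqrt (1 - t) : ℂ)) * (Real.sqrt (1 - t) : ℂ) = 1 - t := by
      rw [← Complex.ofReal_mul, Real.mul_self_sqrt (by linarith)]; push_cast; rfl
    linear_combination (Complex.I * Complex.I) * h + (1 - t : ℂ) * Complex.I_mul_I
  have hstar : ∀ x : ℂ, (c • (1 : Matrix n n ℂ) + x • P)ᴴ = c • 1 + star x • P := fun x => by
    rw [conjTranspose_add, conjTranspose_smul, conjTranspose_smul, hP, conjTranspose_one, hc]
  have hmem : ∀ x : ℂ, star x = -x → x * x = s * s →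
      c • (1 : Matrix n n ℂ) + x • P ∈ unitaryGroup n ℂ := fun x hx hxx => by
    rw [mem_unitaryGroup_iff, star_eq_conjTranspose, hstar, hx]
    simp only [mul_add, add_mul, smul_mul_assoc, mul_smul_comm, one_mul, mul_one, hPP]
    have : (c * c + x * -x) • (1 : Matrix n n ℂ) = 1 := by
      rw [mul_neg, hxx, hcc, hss]; simp
    refine Eq.trans ?_ this
    module
  obtain ⟨E, hE, hEA⟩ := exists_average ⟨_, hmem s hs rfl⟩
    ⟨_, hmem (-s) (by rw [star_neg, hs]) (neg_mul_neg s s)⟩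
  refine ⟨E, hE, fun A => ?_⟩
  rw [hEA]
  simp only [hstar, star_neg, hs, neg_neg, mul_add, add_mul, smul_mul_assoc, mul_smul_comm, one_mul,
    mul_one]
  have h1 : (1 - t : ℂ) = -(s * s) := by rw [hss, neg_neg]
  rw [h1, ← hcc]
  module

theorem exists_transfer_diagonal {n : Type u} [Fintype n] [DecidableEq n] (j k : n) {t : ℝ}
    (ht0 : 0 ≤ t) (ht1 : t ≤ 1) (d : n → ℝ) :
    ∃ E : Matrix n n ℂ →ₗ[ℂ] Matrix n n ℂ, IsNoisyOperation E ∧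
      E (diagonal fun i => (d i : ℂ))
        = diagonal fun i => ((t * d i + (1 - t) * d (Equiv.swap j k i) : ℝ) : ℂ) := by
  obtain ⟨E, hE, hEA⟩ := exists_mix_involution (P := (Equiv.swap j k).permMatrix ℂ)
    (by rw [conjTranspose_permMatrix, Equiv.swap_inv])
    (by rw [← permMatrix_mul, Equiv.swap_mul_self, permMatrix_one]) ht0 ht1
  refine ⟨E, hE, ?_⟩
  have h : (Equiv.swap j k).permMatrix ℂ * diagonal (fun i => (d i : ℂ))
      * (Equiv.swap j k).permMatrix ℂ = diagonal fun i => (d (Equiv.swap j k i) : ℂ) := by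
    rw [Equiv.Perm.permMatrix, PEquiv.toMatrix_toPEquiv_mul, PEquiv.mul_toMatrix_toPEquiv,
      submatrix_submatrix, Equiv.symm_swap]
    exact submatrix_diagonal_equiv _ _
  rw [hEA, h]
  ext i i'
  by_cases hi : i = i'
  · subst hi; simp
  · simp [hi]

end IsNoisyOperation

/-! ### Spectra of states and the two bounds -/

namespace DensityMatrix

open Matrix

variable {n : Type u} [Fintype n] [DecidableEq n]

/-- A bijection from the basis vectors to the positions of their eigenvalues. -/
noncomputable def indexEquiv (n : Type u) [Fintype n] : n ≃ Fin (Fintype.card n) :=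
  (Fintype.equivOfCardEq (Fintype.card_fin _)).symm

theorem exists_unitary_eq (ρ : DensityMatrix n) :
    ∃ U : unitaryGroup n ℂ, ρ.toMatrix = (U : Matrix n n ℂ)
      * diagonal (fun i => (ρ.eigenvalue (indexEquiv n i) : ℂ)) * (U : Matrix n n ℂ)ᴴ :=
  ⟨_, (ρ.posSemidef.isHermitian.spectral_theorem).trans (Unitary.conjStarAlgAut_apply _ _)⟩

theorem eigenvalue_antitone (ρ : DensityMatrix n) : Antitone ρ.eigenvalue :=
  ρ.posSemidef.isHermitian.eigenvalues₀_antitone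

theorem eigenvalue_nonneg (ρ : DensityMatrix n) (i : Fin (Fintype.card n)) :
    0 ≤ ρ.eigenvalue i := by
  have h := ρ.posSemidef.eigenvalues_nonneg ((indexEquiv n).symm i)
  rwa [show ρ.posSemidef.isHermitian.eigenvalues ((indexEquiv n).symm i) = ρ.eigenvalue i from
    congrArg ρ.eigenvalue ((indexEquiv n).apply_symm_apply i)] at h

theorem sum_eigenvalue (ρ : DensityMatrix n) : ∑ i, ρ.eigenvalue i = 1 := by
  have h := ρ.posSemidef.isHermitian.trace_eq_sum_eigenvalues
  rw [ρ.trace_eq_one] at h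
  rw [← (indexEquiv n).sum_comp]
  exact Complex.ofReal_injective
    ((Complex.ofReal_sum _ _).trans (h.symm.trans Complex.ofReal_one.symm))

theorem V_card (ρ : DensityMatrix n) : V (Fintype.card n) ρ = 1 :=
  (Fin.sum_filter_val_lt_self _).trans ρ.sum_eigenvalue

theorem V_nonneg (l : ℕ) (ρ : DensityMatrix n) : 0 ≤ V l ρ :=
  Finset.sum_nonneg fun i _ => ρ.eigenvalue_nonneg i

theorem V_pos {l : ℕ} (hl : 1 ≤ l) (ρ : DensityMatrix n) : 0 < V l ρ := by
  obtain ⟨i, -, hi⟩ : ∃ i ∈ Finset.univ, 0 < ρ.eigenvalue i :=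
    Finset.exists_lt_of_sum_lt (by rw [Finset.sum_const_zero, ρ.sum_eigenvalue]; exact one_pos)
  have h0 : 0 < Fintype.card n := i.pos
  refine Finset.sum_pos' (fun i _ => ρ.eigenvalue_nonneg i)
    ⟨⟨0, h0⟩, Finset.mem_filter.2 ⟨Finset.mem_univ _, hl⟩, hi.trans_le ?_⟩
  exact ρ.eigenvalue_antitone (Fin.le_def.2 (Nat.zero_le _))

/-- The conjugate of a diagonal matrix by a unitary, as a state. -/
def ofUnitary (U : unitaryGroup n ℂ) (d : n → ℝ) (hd : ∀ i, 0 ≤ d i) (hsum : ∑ i, d i = 1) :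
    DensityMatrix n where
  toMatrix := (U : Matrix n n ℂ) * diagonal (fun i => (d i : ℂ)) * (U : Matrix n n ℂ)ᴴ
  posSemidef := (PosSemidef.diagonal fun i =>
    Complex.zero_le_real.2 (hd i)).mul_mul_conjTranspose_same _
  trace_eq_one := by
    rw [trace_mul_cycle, ← star_eq_conjTranspose, UnitaryGroup.star_mul_self, one_mul,
      trace_diagonal, ← Complex.ofReal_sum, hsum, Complex.ofReal_one]

/-- The positive part of `ρ - t` for the threshold `t` given by the `l`-th eigenvalue. -/
theorem exists_threshold (ρ : DensityMatrix n) {l : ℕ} (hl : 1 ≤ l) (hln : l ≤ Fintype.card n) :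
    ∃ (t : ℝ) (B : Matrix n n ℂ), B.PosSemidef ∧ ((t : ℂ) • 1 + B - ρ.toMatrix).PosSemidef ∧
      B.trace = ((V l ρ - l * t : ℝ) : ℂ) := by
  obtain ⟨U, hU⟩ := ρ.exists_unitary_eq
  have hUU : (U : Matrix n n ℂ) * (U : Matrix n n ℂ)ᴴ = 1 := mem_unitaryGroup_iff.1 U.2
  have hUU' : (U : Matrix n n ℂ)ᴴ * (U : Matrix n n ℂ) = 1 := mem_unitaryGroup_iff'.1 U.2
  -- Positions start at `0`, so `l - 1` is the `l`-th largest eigenvalue.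
  set t := ρ.eigenvalue ⟨l - 1, by omega⟩ with ht
  set e := indexEquiv n
  refine ⟨t, (U : Matrix n n ℂ) * diagonal (fun i => ((max (ρ.eigenvalue (e i) - t) 0 : ℝ) : ℂ))
    * (U : Matrix n n ℂ)ᴴ, ?_, ?_, ?_⟩
  · exact (PosSemidef.diagonal fun i =>
      Complex.zero_le_real.2 (le_max_right _ _)).mul_mul_conjTranspose_same _
  · have h : (t : ℂ) • (1 : Matrix n n ℂ)
        = (U : Matrix n n ℂ) * diagonal (fun _ => (t : ℂ)) * (U : Matrix n n ℂ)ᴴ := by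
      rw [← smul_one_eq_diagonal, mul_smul_comm, smul_mul_assoc, mul_one, hUU]
    rw [hU, h, ← add_mul, ← sub_mul, ← mul_add, ← mul_sub, diagonal_add, diagonal_sub]
    refine (PosSemidef.diagonal fun i => ?_).mul_mul_conjTranspose_same _
    rw [← Complex.ofReal_add, ← Complex.ofReal_sub]
    exact Complex.zero_le_real.2 (by linarith [le_max_left (ρ.eigenvalue (e i) - t) 0])
  · rw [trace_mul_cycle, hUU', one_mul, trace_diagonal, ← Complex.ofReal_sum,
      e.sum_comp fun i => max (ρ.eigenvalue i - t) 0,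
      ← Finset.sum_filter_add_sum_filter_not _ (fun i : Fin (Fintype.card n) => i.val < l)]
    congr 1
    have h1 : ∑ i : Fin (Fintype.card n) with i.val < l, max (ρ.eigenvalue i - t) 0
        = ∑ i : Fin (Fintype.card n) with i.val < l, (ρ.eigenvalue i - t) := by
      refine Finset.sum_congr rfl fun i hi => max_eq_left (sub_nonneg.2 ?_)
      have := (Finset.mem_filter.1 hi).2
      refine ρ.eigenvalue_antitone (Fin.le_def.2 ?_)
      simp only
      omega
    have h2 : ∑ i : Fin (Fintype.card n) with ¬ i.val < l, max (ρ.eigenvalue i - t) 0 = 0 := by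
      refine Finset.sum_eq_zero fun i hi => max_eq_right (sub_nonpos.2 ?_)
      have := (Finset.mem_filter.1 hi).2
      refine ρ.eigenvalue_antitone (Fin.le_def.2 ?_)
      simp only
      omega
    rw [h1, h2, Finset.sum_sub_distrib, Finset.sum_const, Fin.card_filter_val_lt,
      min_eq_right hln, nsmul_eq_mul, add_zero]
    rfl

/-- An operator bound on `p σ` bounds the partial sums of its eigenvalues. -/
theorem mul_V_le {σ : DensityMatrix n} {p t : ℝ} {B : Matrix n n ℂ} (hB : B.PosSemidef)
    (h : ((t : ℂ) • 1 + B - (p : ℂ) • σ.toMatrix).PosSemidef) {l : ℕ}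
    (hln : l ≤ Fintype.card n) : p * V l σ ≤ l * t + B.trace.re := by
  obtain ⟨U, hU⟩ := σ.exists_unitary_eq
  have hUU' : (U : Matrix n n ℂ)ᴴ * (U : Matrix n n ℂ) = 1 := mem_unitaryGroup_iff'.1 U.2
  have hUU : (U : Matrix n n ℂ) * (U : Matrix n n ℂ)ᴴ = 1 := mem_unitaryGroup_iff.1 U.2
  set e := indexEquiv n
  -- `B` in the eigenbasis of `σ`: its diagonal is nonnegative, so any part of it sums to at most
  -- the trace.
  set C := (U : Matrix n n ℂ)ᴴ * B * (U : Matrix n n ℂ) with hC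
  have hCpos : C.PosSemidef := hB.conjTranspose_mul_mul_same _
  have hCtr : C.trace = B.trace := by rw [hC, trace_mul_cycle, hUU, one_mul]
  have hCnn : ∀ i, 0 ≤ (C i i).re := fun i => (Complex.nonneg_iff.1 hCpos.diag_nonneg).1
  have hM := h.conjTranspose_mul_mul_same (U : Matrix n n ℂ)
  have hMeq : (U : Matrix n n ℂ)ᴴ * ((t : ℂ) • 1 + B - (p : ℂ) • σ.toMatrix) * (U : Matrix n n ℂ)
      = (t : ℂ) • 1 + C - (p : ℂ) • diagonal (fun i => (σ.eigenvalue (e i) : ℂ)) := by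
    rw [hU]
    simp only [mul_sub, sub_mul, mul_add, add_mul, mul_smul_comm, smul_mul_assoc, mul_one, hUU']
    congr 2
    simp only [← mul_assoc, hUU', one_mul]
    rw [mul_assoc, hUU', mul_one]
  rw [hMeq] at hM
  have hdiag : ∀ i, p * σ.eigenvalue i ≤ t + (C (e.symm i) (e.symm i)).re := fun i => by
    have h1 := (Complex.nonneg_iff.1 (hM.diag_nonneg (i := e.symm i))).1
    simp at h1
    linarith
  have hsum : ∑ i : Fin (Fintype.card n) with i.val < l, p * σ.eigenvalue i
      ≤ ∑ i : Fin (Fintype.card n) with i.val < l, (t + (C (e.symm i) (e.symm i)).re) :=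
    Finset.sum_le_sum fun i _ => hdiag i
  rw [← Finset.mul_sum, Finset.sum_add_distrib, Finset.sum_const, Fin.card_filter_val_lt,
    min_eq_right hln, nsmul_eq_mul] at hsum
  have htr : ∑ i : Fin (Fintype.card n) with i.val < l, (C (e.symm i) (e.symm i)).re
      ≤ B.trace.re := by
    rw [← hCtr, trace, Complex.re_sum, ← e.symm.sum_comp]
    exact Finset.sum_le_sum_of_subset_of_nonneg (Finset.filter_subset _ _) fun i _ _ => hCnn _
  exact hsum.trans (by linarith)

theorem mul_V_le_of_noisyOperation [Nonempty n] {ρ σ X : DensityMatrix n} {p : ℝ} (hp : p ≤ 1)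
    {E : Matrix n n ℂ →ₗ[ℂ] Matrix n n ℂ} (hE : IsNoisyOperation E)
    (h : E ρ.toMatrix = (p : ℂ) • σ.toMatrix + (1 - p : ℂ) • X.toMatrix) {l : ℕ} (hl : 1 ≤ l)
    (hln : l ≤ Fintype.card n) : p * V l σ ≤ V l ρ := by
  obtain ⟨t, B, hB, hBρ, htr⟩ := ρ.exists_threshold hl hln
  have h1 := hE.map_posSemidef hBρ
  rw [map_sub, map_add, map_smul, hE.map_one, h] at h1
  have hX : ((1 - p : ℂ) • X.toMatrix).PosSemidef := by
    refine X.posSemidef.smul ?_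
    rw [← Complex.ofReal_one, ← Complex.ofReal_sub]
    exact Complex.zero_le_real.2 (sub_nonneg.2 hp)
  -- Adding back `(1 - p) X ≥ 0` leaves a bound on `p σ` alone.
  have h2 := h1.add hX
  rw [← sub_sub, sub_add_cancel] at h2
  have h3 := mul_V_le (hE.map_posSemidef hB) h2 hln
  rw [hE.trace_map, htr, Complex.ofReal_re] at h3
  linarith

/-- If the spectrum of `ρ` majorizes the decreasing vector `z`, then a noisy operation takes `ρ` to
any state with spectrum `z`. -/
theorem exists_noisyOperation_of_majorizes (ρ : DensityMatrix n) (W : unitaryGroup n ℂ)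
    {z : Fin (Fintype.card n) → ℝ} (hz : Antitone z) (hsum : ∑ i, z i = 1)
    (hle : ∀ l ≤ Fintype.card n, ∑ i : Fin (Fintype.card n) with i.val < l, z i ≤ V l ρ) :
    ∃ E : Matrix n n ℂ →ₗ[ℂ] Matrix n n ℂ, IsNoisyOperation E ∧
      E ρ.toMatrix = (W : Matrix n n ℂ) * diagonal (fun i => (z (indexEquiv n i) : ℂ))
        * (W : Matrix n n ℂ)ᴴ := by
  set e := indexEquiv n with he
  have hdiag : ∃ E : Matrix n n ℂ →ₗ[ℂ] Matrix n n ℂ, IsNoisyOperation E ∧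
      E ρ.toMatrix = diagonal (fun i => (z (e i) : ℂ)) := by
    refine transfer_induction (S := fun a => ∃ E : Matrix n n ℂ →ₗ[ℂ] Matrix n n ℂ,
      IsNoisyOperation E ∧ E ρ.toMatrix = diagonal (fun i => (a (e i) : ℂ))) ?_ hz
      (ρ.sum_eigenvalue.trans hsum.symm) hle ?_
    · rintro a j k t ht0 ht1 ⟨E, hE, hEa⟩
      obtain ⟨F, hF, hFa⟩ := IsNoisyOperation.exists_transfer_diagonal (e.symm j) (e.symm k)
        ht0 ht1 (a ∘ e)
      refine ⟨F ∘ₗ E, hE.comp hF, ?_⟩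
      rw [LinearMap.comp_apply, hEa]
      refine hFa.trans ?_
      congr 1
      funext i
      have hswap : e (Equiv.swap (e.symm j) (e.symm k) i) = Equiv.swap j k (e i) := by
        rw [e.injective.map_swap, e.apply_symm_apply, e.apply_symm_apply]
      simp only [Function.comp_apply, hswap]
    · obtain ⟨U, hU⟩ := ρ.exists_unitary_eq
      have hUU' : (U : Matrix n n ℂ)ᴴ * (U : Matrix n n ℂ) = 1 := mem_unitaryGroup_iff'.1 U.2
      refine ⟨_, .applyUnitary (star U), ?_⟩
      change (U : Matrix n n ℂ)ᴴ * ρ.toMatrix * (U : Matrix n n ℂ)ᴴᴴ = _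
      rw [hU, conjTranspose_conjTranspose]
      simp only [← mul_assoc, hUU', one_mul]
      rw [mul_assoc, hUU', mul_one]
  obtain ⟨E, hE, hEz⟩ := hdiag
  exact ⟨_, hE.comp (.applyUnitary W), by rw [LinearMap.comp_apply, hEz]; rfl⟩

theorem mem_noisyTransitionProbabilities {ρ σ : DensityMatrix n} {p : ℝ} (hp0 : 0 ≤ p)
    (hp1 : p ≤ 1) (h : ∀ l ≤ Fintype.card n, p * V l σ ≤ V l ρ) :
    p ∈ noisyTransitionProbabilities ρ σ := by
  obtain ⟨z, hz, hqz, hsum, hle⟩ := exists_majorized_ge (q := fun i => p * σ.eigenvalue i)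
    (r := ρ.eigenvalue) (fun i j hij => mul_le_mul_of_nonneg_left (σ.eigenvalue_antitone hij) hp0)
    ρ.eigenvalue_antitone (fun l hl => by rw [← Finset.mul_sum]; exact h l hl)
  rw [ρ.sum_eigenvalue] at hsum
  obtain ⟨W, hW⟩ := σ.exists_unitary_eq
  obtain ⟨E, hE, hEz⟩ := ρ.exists_noisyOperation_of_majorizes W hz hsum hle
  set e := indexEquiv n
  have hdiff : ∑ i, (z (e i) - p * σ.eigenvalue (e i)) = 1 - p := by
    rw [e.sum_comp fun i => z i - p * σ.eigenvalue i, Finset.sum_sub_distrib, ← Finset.mul_sum,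
      hsum, σ.sum_eigenvalue, mul_one]
  have hnn : ∀ i, 0 ≤ z (e i) - p * σ.eigenvalue (e i) := fun i => sub_nonneg.2 (hqz (e i))
  -- `X` is the excess divided by `1 - p`. At `p = 1` the excess vanishes and any state serves as
  -- `X`.
  rcases hp1.lt_or_eq with hlt | rfl
  · have hpos : 0 < 1 - p := sub_pos.2 hlt
    refine ⟨hp0, hp1, ofUnitary W (fun i => (z (e i) - p * σ.eigenvalue (e i)) / (1 - p))
      (fun i => div_nonneg (hnn i) hpos.le) ?_, E, hE, ?_⟩
    · rw [← Finset.sum_div, hdiff, div_self hpos.ne']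
    · have hsmul : ∀ (c : ℂ) (d : n → ℂ), c • ((W : Matrix n n ℂ) * diagonal d
          * (W : Matrix n n ℂ)ᴴ) = W * diagonal (c • d) * (W : Matrix n n ℂ)ᴴ := fun c d => by
        rw [diagonal_smul, Matrix.mul_smul, Matrix.smul_mul]
      rw [hEz, hW]
      refine Eq.trans ?_ (congrArg₂ (· + ·) (hsmul _ _) (hsmul _ _)).symm
      simp only [← add_mul, ← mul_add, diagonal_add]
      congr 3
      funext i
      have hne : (1 - p : ℂ) ≠ 0 := by exact_mod_cast hpos.ne'
      simp only [Pi.smul_apply, smul_eq_mul]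
      push_cast
      field_simp
      ring
  · refine ⟨hp0, hp1, ρ, E, hE, ?_⟩
    rw [sub_self] at hdiff
    have heq := (Finset.sum_eq_zero_iff_of_nonneg fun i _ => hnn i).1 hdiff
    rw [hEz, hW, Complex.ofReal_one, sub_self, zero_smul, one_smul, add_zero]
    congr 3
    funext i
    rw [sub_eq_zero.1 (heq i (Finset.mem_univ i)), one_mul]

end DensityMatrix

theorem mainTheorem2 {n : Type u} [Fintype n] [DecidableEq n] [Nonempty n]
    (ρ σ : DensityMatrix n) :
    IsGreatest (noisyTransitionProbabilities ρ σ)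
      ((Finset.Icc 1 (Fintype.card n)).inf' (Finset.nonempty_Icc.2 Fintype.card_pos)
        (fun l => DensityMatrix.V l ρ / DensityMatrix.V l σ)) := by
  constructor
  · refine DensityMatrix.mem_noisyTransitionProbabilities ?_ ?_ fun l hl => ?_
    · exact Finset.le_inf' _ _ fun l _ => div_nonneg (ρ.V_nonneg l) (σ.V_nonneg l)
    -- The term `l = n` equals `1`.
    · refine (Finset.inf'_le _ (Finset.mem_Icc.2 ⟨Fintype.card_pos, le_rfl⟩)).trans_eq ?_
      rw [DensityMatrix.V_card, DensityMatrix.V_card, div_one]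
    · rcases Nat.eq_zero_or_pos l with rfl | hl0
      · simp [DensityMatrix.V]
      · rw [← le_div_iff₀ (DensityMatrix.V_pos hl0 σ)]
        exact Finset.inf'_le (fun l => DensityMatrix.V l ρ / DensityMatrix.V l σ)
          (Finset.mem_Icc.2 ⟨hl0, hl⟩)
  · rintro p ⟨-, hp1, X, E, hE, hEρ⟩
    refine Finset.le_inf' _ _ fun l hl => ?_
    obtain ⟨hl1, hln⟩ := Finset.mem_Icc.1 hl
    rw [le_div_iff₀ (DensityMatrix.V_pos hl1 σ)]
    exact DensityMatrix.mul_V_le_of_noisyOperation hp1 hE hEρ hl1 hln
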